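/- Let $E$ be a (real) Banach lattice with norm dual $E'$, which is a Banach lattice for the order $f\le g \iff f(x)\le g(x)$ for all $x\in E_+$. A Banach lattice has order continuous norm if $\|x_\alpha\|\to 0$ for every net $x_\alpha\downarrow 0$ in it. A net $(x_\alpha)$ in $E$ is called * weakly null if $f(x_\alpha)\to 0$ for all $f\in E'$; * $|\sigma|(E,E')$-null if $|f|(|x_\alpha|)\to 0$ for all $f\in E'$, equivalently $f(|x_\alpha|)\to0$ for all $f\in E'_+$; * uaw-null if $|x_\alpha|\wedge u\to 0$ weakly for every $u\in E_+$; * un-null if $\||x_\alpha|\wedge u\|\to 0$ for every $u\in E_+$; * uo-null if $|x_\alpha|\wedge u$ converges in order to $0$ for every $u\in E_+$, where a net $(z_\alpha)$ converges in order to $0$ if there is a net $y_\beta\downarrow 0$ such that for every $\beta$ there is $\alpha_0$ with $|z_\alpha|\le y_\beta$ for all $\alpha\ge\alpha_0$. Then the following are equivalent: 1. $E'$ has order continuous norm; 2. every norm bounded uaw-null net in $E$ is weakly null; 3. every norm bounded uaw-null net in $E$ is $|\sigma|(E,E')$-null; 4. every norm bounded uaw-null sequence in $E$ is weakly null; 5.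 every norm bounded uaw-null sequence in $E$ is $|\sigma|(E,E')$-null. If, in addition, $E$ has order continuous norm, then these conditions are also equivalent to each of the following: 6. every norm bounded uo-null net in $E$ is weakly null; 7. every norm bounded uo-null net in $E$ is $|\sigma|(E,E')$-null; 8. every norm bounded uo-null sequence in $E$ is weakly null; 9. every norm bounded uo-null sequence in $E$ is $|\sigma|(E,E')$-null; 10. every norm bounded un-null net in $E$ is weakly null; 11. every norm bounded un-null net in $E$ is $|\sigma|(E,E')$-null; 12. every norm bounded un-null sequence in $E$ is weakly null; 13. every norm bounded un-null sequence in $E$ is $|\sigma|(E,E')$-null. -/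

import Mathlib

open Filter Topology

universe u v

namespace BanachLattice

section Dual

variable {E : Type u} [NormedAddCommGroup E] [NormedSpace ℝ E] [Lattice E] [IsOrderedAddMonoid E]

/-- The order of the dual Banach lattice `E'`: `f ≤ g` iff `f x ≤ g x` for every `x ≥ 0`. -/
instance dualPartialOrder : PartialOrder (StrongDual ℝ E) where
  le f g := ∀ x : E, 0 ≤ x → f x ≤ g x
  le_refl _ _ _ := le_rfl
  le_trans _ _ _ hfg hgh x hx := (hfg x hx).trans (hgh x hx)
  le_antisymm f g hfg hgf := by
    have key : ∀ x : E, 0 ≤ x → f x = g x := fun x hx => le_antisymm (hfg x hx) (hgf x hx)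
    ext x
    rw [← posPart_sub_negPart x, map_sub, map_sub, key _ (posPart_nonneg x),
      key _ (negPart_nonneg x)]

theorem dual_le_iff (f g : StrongDual ℝ E) : f ≤ g ↔ ∀ x : E, 0 ≤ x → f x ≤ g x := Iff.rfl

end Dual

/-- The norm of `X` is order continuous: `‖x_α‖ → 0` for every net `x_α ↓ 0`.
Index sets in the universe of `X` are enough, since a decreasing net may be replaced by its
range. -/
def OrderContinuousNorm (X : Type u) [NormedAddCommGroup X] [PartialOrder X] : Prop :=
  ∀ (ι : Type u) [Preorder ι] [IsDirectedOrder ι] [Nonempty ι] (x : ι → X),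
    Antitone x → IsGLB (Set.range x) 0 → Tendsto (fun i => ‖x i‖) atTop (𝓝 0)

section Convergence

variable {E : Type u} [NormedAddCommGroup E] [Lattice E] {ι : Type v} [Preorder ι]

/-- Order convergence of the net `x` to `a`: there is a net `y ↓ 0`, possibly over another index
set, such that for every `k` eventually `|x_i - a| ≤ y_k`. -/
def OrderConv (x : ι → E) (a : E) : Prop :=
  ∃ (κ : Type u) (_ : Preorder κ) (_ : IsDirectedOrder κ) (_ : Nonempty κ) (y : κ → E),
    Antitone y ∧ IsGLB (Set.range y) 0 ∧ ∀ k, ∃ i₀, ∀ i, i₀ ≤ i → |x i - a| ≤ y k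

/-- Unbounded order (`uo`) convergence. -/
def UOConv (x : ι → E) (a : E) : Prop :=
  ∀ u : E, 0 ≤ u → OrderConv (fun i => |x i - a| ⊓ u) 0

/-- Unbounded norm (`un`) convergence. -/
def UNConv (x : ι → E) (a : E) : Prop :=
  ∀ u : E, 0 ≤ u → Tendsto (fun i => ‖|x i - a| ⊓ u‖) atTop (𝓝 0)

variable [NormedSpace ℝ E]

/-- Convergence in the weak topology `σ(E, E')`. -/
def WeakConv (x : ι → E) (a : E) : Prop :=
  Tendsto (fun i => toWeakSpace ℝ E (x i)) atTop (𝓝 (toWeakSpace ℝ E a))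

/-- Unbounded absolute weak (`uaw`) convergence. -/
def UAWConv (x : ι → E) (a : E) : Prop :=
  ∀ u : E, 0 ≤ u → WeakConv (fun i => |x i - a| ⊓ u) 0

/-- Convergence in the absolute weak topology `|σ|(E, E')`, which is given by the seminorms
`x ↦ |f| |x|`, `f ∈ E'`, that is, by the seminorms `x ↦ f |x|` for the positive `f ∈ E'`. -/
def AbsWeakConv [IsOrderedAddMonoid E] (x : ι → E) (a : E) : Prop :=
  ∀ f : StrongDual ℝ E, 0 ≤ f → Tendsto (fun i => f |x i - a|) atTop (𝓝 0)

end Convergence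

end BanachLattice

/-! Everything passes through norm bounded disjoint positive sequences. Such a sequence is
automatically uaw-null and uo-null, so each convergence condition that applies to it makes it weakly
null.

Weak nullness of all these sequences is equivalent to order continuity of the dual norm. If the dual
norm is order continuous, the components of `f ≥ 0` on the bands generated by the disjoint `a n`
have sum at most `f`. The tails of this series decrease to `0`, hence in norm, and they control `f
(a n)`. Conversely, a gliding hump argument yields `BallsAlmostOrderBounded`: for each `f ≥ 0`, a
single `u` makes `f (x - u)⁺` small for all positive `x` in a ball. This makes pointwise convergence
of decreasing functionals uniform on the unit ball.

The same property, through `|x| = |x| ⊓ u + (|x| - u)⁺`, makes bounded uaw-null nets `|σ|(E,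
E')`-null. If `E` has order continuous norm, uo-null implies un-null, which always implies uaw-null,
so the remaining conditions fit in between. -/

namespace BanachLattice

/-! ### Disjointness in lattice-ordered groups -/

section LatticeOrderedGroup

variable {G : Type*} [Lattice G] [AddCommGroup G] [IsOrderedAddMonoid G]

theorem sub_inf_eq_posPart_sub (a b : G) : a - a ⊓ b = (a - b)⁺ := by
  rw [inf_eq_sub_posPart_sub, sub_sub_cancel]

theorem add_inf_le_inf_add_inf {a b c : G} (ha : 0 ≤ a) (hb : 0 ≤ b) (hc : 0 ≤ c) :
    (a + b) ⊓ c ≤ a ⊓ c + b ⊓ c := by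
  rw [add_inf, inf_add, inf_add]
  refine le_inf (le_inf inf_le_left ?_) (le_inf ?_ ?_)
  · exact inf_le_right.trans (le_add_of_nonneg_right hb)
  · exact inf_le_right.trans (le_add_of_nonneg_left ha)
  · exact inf_le_right.trans (le_add_of_nonneg_right hc)

theorem inf_add_inf_le_add_inf_add (a b c d : G) : a ⊓ c + b ⊓ d ≤ (a + b) ⊓ (c + d) :=
  le_inf (add_le_add inf_le_left inf_le_left) (add_le_add inf_le_right inf_le_right)

theorem posPart_sub_inf_posPart_sub_swap (a b : G) : (a - b)⁺ ⊓ (b - a)⁺ = 0 := by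
  rw [← neg_sub a b, posPart_neg, posPart_inf_negPart_eq_zero]

omit [IsOrderedAddMonoid G] in
theorem inf_eq_zero_mono {a b c d : G} (hc : 0 ≤ c) (hd : 0 ≤ d) (hca : c ≤ a) (hdb : d ≤ b)
    (h : a ⊓ b = 0) : c ⊓ d = 0 :=
  le_antisymm ((inf_le_inf hca hdb).trans h.le) (le_inf hc hd)

theorem add_le_of_inf_eq_zero {a b c : G} (h : a ⊓ b = 0) (ha : a ≤ c) (hb : b ≤ c) :
    a + b ≤ c := by
  rw [← inf_add_sup, h, zero_add]
  exact sup_le ha hb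

theorem add_inf_eq_zero {a b c : G} (ha : 0 ≤ a) (hb : 0 ≤ b) (hc : 0 ≤ c) (hac : a ⊓ c = 0)
    (hbc : b ⊓ c = 0) : (a + b) ⊓ c = 0 := by
  refine le_antisymm ((add_inf_le_inf_add_inf ha hb hc).trans ?_) (le_inf (add_nonneg ha hb) hc)
  rw [hac, hbc, zero_add]

theorem nsmul_inf_eq_zero {a c : G} (ha : 0 ≤ a) (hc : 0 ≤ c) (hac : a ⊓ c = 0) (n : ℕ) :
    (n • a) ⊓ c = 0 := by
  induction n with
  | zero => simpa using hc
  | succ n ih => rw [succ_nsmul]; exact add_inf_eq_zero (nsmul_nonneg ha n) ha hc ih hac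

theorem sum_inf_eq_zero {ι : Type*} {s : Finset ι} {a : ι → G} {c : G} (ha : ∀ i, 0 ≤ a i)
    (hc : 0 ≤ c) (h : ∀ i ∈ s, a i ⊓ c = 0) : (∑ i ∈ s, a i) ⊓ c = 0 := by
  classical
  induction s using Finset.induction_on with
  | empty => simpa using hc
  | insert i s hi ih =>
    rw [Finset.sum_insert hi]
    exact add_inf_eq_zero (ha i) (Finset.sum_nonneg fun j _ => ha j) hc
      (h i (Finset.mem_insert_self i s)) (ih fun j hj => h j (Finset.mem_insert_of_mem hj))

/-- A sum of disjoint positive elements is their supremum, since `a + b = a ⊓ b + a ⊔ b`. -/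
theorem sum_le_of_pairwise_inf_eq_zero {ι : Type*} (s : Finset ι) {a : ι → G} {c : G}
    (ha : ∀ i, 0 ≤ a i) (hc : 0 ≤ c) (hac : ∀ i, a i ≤ c)
    (h : Pairwise fun i j => a i ⊓ a j = 0) : ∑ i ∈ s, a i ≤ c := by
  classical
  induction s using Finset.induction_on with
  | empty => simpa using hc
  | insert i s hi ih =>
    rw [Finset.sum_insert hi, add_comm]
    refine add_le_of_inf_eq_zero (sum_inf_eq_zero ha (ha i) fun j hj => h ?_) ih (hac i)
    rintro rfl
    exact hi hj

end LatticeOrderedGroup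

/-! ### Positive functionals -/

section PositiveFunctional

variable {E : Type u} [NormedAddCommGroup E] [NormedSpace ℝ E] [Lattice E] [IsOrderedAddMonoid E]

theorem dual_nonneg_apply {f : StrongDual ℝ E} (hf : 0 ≤ f) {x : E} (hx : 0 ≤ x) : 0 ≤ f x :=
  hf x hx

theorem dual_mono_of_nonneg {f : StrongDual ℝ E} (hf : 0 ≤ f) {x y : E} (hxy : x ≤ y) :
    f x ≤ f y := by
  have := dual_nonneg_apply hf (sub_nonneg.2 hxy)
  rw [map_sub] at this
  exact sub_nonneg.1 this

theorem abs_apply_le_apply_abs {f : StrongDual ℝ E} (hf : 0 ≤ f) (x : E) : |f x| ≤ f |x| := by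
  refine abs_le.2 ⟨?_, dual_mono_of_nonneg hf (le_abs_self x)⟩
  rw [neg_le, ← map_neg]
  exact dual_mono_of_nonneg hf (neg_le_abs x)

variable [HasSolidNorm E]

omit [NormedSpace ℝ E] in
theorem norm_le_norm_of_nonneg_of_le {x y : E} (hx : 0 ≤ x) (hxy : x ≤ y) : ‖x‖ ≤ ‖y‖ :=
  norm_le_norm_of_abs_le_abs (by rwa [abs_of_nonneg hx, abs_of_nonneg (hx.trans hxy)])

/-- An additive function on the positive cone which is bounded on the unit ball extends to a
continuous linear functional. -/
theorem exists_dual_eq_on_nonneg (p : E → ℝ) (C : ℝ)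
    (hadd : ∀ x y, 0 ≤ x → 0 ≤ y → p (x + y) = p x + p y)
    (hC : ∀ x, 0 ≤ x → |p x| ≤ C * ‖x‖) :
    ∃ g : StrongDual ℝ E, ∀ x, 0 ≤ x → g x = p x := by
  have h0 : p 0 = 0 := by simpa using hadd 0 0 le_rfl le_rfl
  let φ : E →+ ℝ :=
    { toFun := fun x => p x⁺ - p x⁻
      map_zero' := by simp
      map_add' := fun x y => by
        -- `p` is additive only on the cone, so the identity is arranged with positive terms on both
        -- sides.
        have h : (x + y)⁺ + (x⁻ + y⁻) = (x⁺ + y⁺) + (x + y)⁻ := by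
          rw [← sub_eq_zero]
          calc _ = ((x + y)⁺ - (x + y)⁻) - ((x⁺ - x⁻) + (y⁺ - y⁻)) := by abel
            _ = 0 := by simp only [posPart_sub_negPart, sub_self]
        have h' := congrArg p h
        rw [hadd _ _ (posPart_nonneg _) (add_nonneg (negPart_nonneg _) (negPart_nonneg _)),
          hadd _ _ (negPart_nonneg _) (negPart_nonneg _),
          hadd _ _ (add_nonneg (posPart_nonneg _) (posPart_nonneg _)) (negPart_nonneg _),
          hadd _ _ (posPart_nonneg _) (posPart_nonneg _)] at h'
        linarith }
  have hφ : ∀ x, ‖φ x‖ ≤ (2 * |C|) * ‖x‖ := fun x => by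
    have key : ∀ y, 0 ≤ y → y ≤ |x| → |p y| ≤ |C| * ‖x‖ := fun y hy hyx => by
      refine (hC y hy).trans ?_
      refine mul_le_mul (le_abs_self C) ?_ (norm_nonneg _) (abs_nonneg _)
      exact (norm_le_norm_of_nonneg_of_le hy hyx).trans (norm_abs_eq_norm x).le
    have h1 := key _ (posPart_nonneg x) (sup_le (le_abs_self x) (abs_nonneg x))
    have h2 := key _ (negPart_nonneg x) (sup_le (neg_le_abs x) (abs_nonneg x))
    calc ‖φ x‖ = |p x⁺ - p x⁻| := rfl
      _ ≤ |p x⁺| + |p x⁻| := abs_sub _ _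
      _ ≤ (2 * |C|) * ‖x‖ := by linarith
  refine ⟨φ.toRealLinearMap (AddMonoidHomClass.continuous_of_bound φ _ hφ), fun x hx => ?_⟩
  change p x⁺ - p x⁻ = p x
  rw [posPart_of_nonneg hx, negPart_of_nonneg hx, h0, sub_zero]

/-- Every functional is dominated by a positive functional. -/
theorem exists_nonneg_ge (f : StrongDual ℝ E) : ∃ g : StrongDual ℝ E, 0 ≤ g ∧ f ≤ g := by
  have hbd : ∀ x : E, ∀ y ∈ Set.Icc 0 x, f y ≤ ‖f‖ * ‖x‖ := fun x y hy =>
    (le_abs_self _).trans ((f.le_opNorm y).trans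
      (mul_le_mul_of_nonneg_left (norm_le_norm_of_nonneg_of_le hy.1 hy.2) (norm_nonneg f)))
  have hbdd : ∀ x : E, BddAbove (f '' Set.Icc 0 x) := fun x =>
    ⟨‖f‖ * ‖x‖, by rintro _ ⟨y, hy, rfl⟩; exact hbd x y hy⟩
  have hne : ∀ x : E, 0 ≤ x → (f '' Set.Icc 0 x).Nonempty := fun x hx =>
    ⟨f 0, 0, ⟨le_rfl, hx⟩, rfl⟩
  have hle : ∀ x y : E, y ∈ Set.Icc 0 x → f y ≤ sSup (f '' Set.Icc 0 x) := fun x y hy =>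
    le_csSup (hbdd x) ⟨y, hy, rfl⟩
  have hnn : ∀ x : E, 0 ≤ x → 0 ≤ sSup (f '' Set.Icc 0 x) := fun x hx => by
    simpa using hle x 0 ⟨le_rfl, hx⟩
  -- Riesz–Kantorovich formula for `f⁺`; additivity comes from splitting `z ≤ x + y` as `z ⊓ x + (z
  -- - z ⊓ x)`.
  obtain ⟨g, hg⟩ := exists_dual_eq_on_nonneg (fun x => sSup (f '' Set.Icc 0 x)) ‖f‖
    (fun x y hx hy => by
      refine le_antisymm (csSup_le (hne _ (add_nonneg hx hy)) ?_) ?_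
      · rintro _ ⟨z, hz, rfl⟩
        have h1 : f (z ⊓ x) ≤ _ := hle x (z ⊓ x) ⟨le_inf hz.1 hx, inf_le_right⟩
        have h2 : f (z - z ⊓ x) ≤ _ := hle y (z - z ⊓ x) ⟨sub_nonneg.2 inf_le_left, by
          rw [sub_inf_eq_posPart_sub]
          exact sup_le (sub_le_iff_le_add'.2 hz.2) hy⟩
        rw [map_sub] at h2
        linarith
      · rw [← le_sub_iff_add_le]
        refine csSup_le (hne x hx) ?_
        rintro _ ⟨a, ha, rfl⟩
        rw [le_sub_comm]
        refine csSup_le (hne y hy) ?_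
        rintro _ ⟨b, hb, rfl⟩
        rw [le_sub_iff_add_le', ← map_add]
        exact hle _ _ ⟨add_nonneg ha.1 hb.1, add_le_add ha.2 hb.2⟩)
    (fun x hx => by
      rw [abs_of_nonneg (hnn x hx)]
      refine csSup_le (hne x hx) ?_
      rintro _ ⟨y, hy, rfl⟩
      exact hbd x y hy)
  refine ⟨g, fun x hx => ?_, fun x hx => ?_⟩
  · rw [hg x hx]
    exact hnn x hx
  · rw [hg x hx]
    exact hle x x ⟨hx, le_rfl⟩

/-- Every functional is a difference of positive functionals. -/
theorem exists_nonneg_sub_nonneg (f : StrongDual ℝ E) :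
    ∃ g h : StrongDual ℝ E, 0 ≤ g ∧ 0 ≤ h ∧ f = g - h := by
  obtain ⟨g, hg, hfg⟩ := exists_nonneg_ge f
  refine ⟨g, g - f, hg, fun x hx => ?_, (sub_sub_cancel g f).symm⟩
  exact sub_nonneg.2 (hfg x hx)

end PositiveFunctional

end BanachLattice

namespace BanachLattice

theorem tendsto_ulift_down_nat : Tendsto (ULift.down : ULift.{v} ℕ → ℕ) atTop atTop :=
  tendsto_atTop.2 fun n => eventually_atTop.2 ⟨ULift.up n, fun _ hk => hk⟩

theorem tendsto_ulift_up_nat : Tendsto (ULift.up : ℕ → ULift.{v} ℕ) atTop atTop :=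
  tendsto_atTop.2 fun n => eventually_atTop.2 ⟨n.down, fun _ hk => hk⟩

/-! ### Components of a functional on bands -/

section BandComponent

variable {E : Type u} [NormedAddCommGroup E] [NormedSpace ℝ E] [Lattice E] [IsOrderedAddMonoid E]

/-- The value at `y ≥ 0` of the component of the positive functional `f` carried by the band
generated by `v ≥ 0`. -/
noncomputable def bandComponent (f : StrongDual ℝ E) (v y : E) : ℝ :=
  ⨆ k : ℕ, f (y ⊓ k • v)

variable {f : StrongDual ℝ E} {v x y : E}

theorem tendsto_bandComponent (hf : 0 ≤ f) (hv : 0 ≤ v) (y : E) :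
    Tendsto (fun k : ℕ => f (y ⊓ k • v)) atTop (𝓝 (bandComponent f v y)) := by
  refine tendsto_atTop_ciSup (fun k l hkl => dual_mono_of_nonneg hf ?_)
    ⟨f y, by rintro _ ⟨k, rfl⟩; exact dual_mono_of_nonneg hf inf_le_left⟩
  exact inf_le_inf_left _ (nsmul_le_nsmul_left hv hkl)

theorem le_bandComponent (hf : 0 ≤ f) (v y : E) (k : ℕ) :
    f (y ⊓ k • v) ≤ bandComponent f v y :=
  le_ciSup (f := fun k : ℕ => f (y ⊓ k • v))
    ⟨f y, by rintro _ ⟨k, rfl⟩; exact dual_mono_of_nonneg hf inf_le_left⟩ k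

theorem bandComponent_nonneg (hf : 0 ≤ f) (hy : 0 ≤ y) : 0 ≤ bandComponent f v y := by
  simpa [hy] using le_bandComponent hf v y 0

theorem bandComponent_add (hf : 0 ≤ f) (hv : 0 ≤ v) (hx : 0 ≤ x) (hy : 0 ≤ y) :
    bandComponent f v (x + y) = bandComponent f v x + bandComponent f v y := by
  have hlim := (tendsto_bandComponent hf hv x).add (tendsto_bandComponent hf hv y)
  apply le_antisymm
  · refine le_of_tendsto_of_tendsto' (tendsto_bandComponent hf hv (x + y)) hlim fun k => ?_
    rw [← map_add]
    exact dual_mono_of_nonneg hf (add_inf_le_inf_add_inf hx hy (nsmul_nonneg hv k))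
  · refine le_of_tendsto' hlim fun k => ?_
    -- The index doubles because two truncations at `k • v` add up to at most `2k • v`.
    refine le_trans ?_ (le_bandComponent hf v (x + y) (k + k))
    rw [← map_add, add_nsmul]
    exact dual_mono_of_nonneg hf (inf_add_inf_le_add_inf_add _ _ _ _)

/-- For fixed `k` the elements `y ⊓ k • a i` are disjoint and below `y`, so their sum is at most
`y`. -/
theorem sum_bandComponent_le {ι : Type*} (s : Finset ι) {a : ι → E} (hf : 0 ≤ f)
    (ha : ∀ i, 0 ≤ a i) (hd : Pairwise fun i j => a i ⊓ a j = 0) (hy : 0 ≤ y) :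
    ∑ i ∈ s, bandComponent f (a i) y ≤ f y := by
  refine le_of_tendsto' (tendsto_finsetSum s fun i _ => tendsto_bandComponent hf (ha i) y)
    fun k => ?_
  rw [← map_sum]
  have hnn : ∀ i, 0 ≤ y ⊓ k • a i := fun i => le_inf hy (nsmul_nonneg (ha i) k)
  refine dual_mono_of_nonneg hf
    (sum_le_of_pairwise_inf_eq_zero s hnn hy (fun _ => inf_le_left) fun i j hij => ?_)
  refine inf_eq_zero_mono (hnn i) (hnn j) inf_le_right inf_le_right ?_
  refine nsmul_inf_eq_zero (ha i) (nsmul_nonneg (ha j) k) ?_ k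
  rw [inf_comm]
  refine nsmul_inf_eq_zero (ha j) (ha i) ?_ k
  rw [inf_comm]
  exact hd hij

end BandComponent

/-! ### Order continuity of the dual norm and disjoint sequences -/

section

variable {E : Type u} [NormedAddCommGroup E] [NormedSpace ℝ E] [Lattice E] [IsOrderedAddMonoid E]
  [HasSolidNorm E]

/-- If the dual norm is order continuous, then positive functionals tend to zero along norm
bounded disjoint positive sequences. -/
theorem OrderContinuousNorm.tendsto_apply_of_disjoint
    (h : OrderContinuousNorm (StrongDual ℝ E)) {f : StrongDual ℝ E} (hf : 0 ≤ f) {a : ℕ → E}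
    (ha : ∀ n, 0 ≤ a n) (hd : Pairwise fun i j => a i ⊓ a j = 0) {M : ℝ} (hM : ∀ n, ‖a n‖ ≤ M) :
    Tendsto (fun n => f (a n)) atTop (𝓝 0) := by
  set p : ℕ → E → ℝ := fun n y => bandComponent f (a n) y with hp
  have hd' : ∀ N, Pairwise fun i j => a (i + N) ⊓ a (j + N) = 0 := fun N i j hij =>
    hd (by simpa using hij)
  have hpnn : ∀ n y, 0 ≤ y → 0 ≤ p n y := fun n y hy => bandComponent_nonneg hf hy
  have hsum : ∀ N y, 0 ≤ y → ∀ s : Finset ℕ, ∑ i ∈ s, p (i + N) y ≤ f y := fun N y hy s =>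
    sum_bandComponent_le s hf (fun i => ha (i + N)) (hd' N) hy
  have hsummable : ∀ N y, 0 ≤ y → Summable fun i => p (i + N) y := fun N y hy =>
    summable_of_sum_le (fun i => hpnn _ y hy) (hsum N y hy)
  have htnn : ∀ N y, 0 ≤ y → 0 ≤ ∑' i, p (i + N) y := fun N y hy =>
    tsum_nonneg fun i => hpnn _ y hy
  have ht : ∀ N, ∃ g : StrongDual ℝ E, ∀ y, 0 ≤ y → g y = ∑' i, p (i + N) y := fun N => by
    refine exists_dual_eq_on_nonneg _ ‖f‖ (fun x y hx hy => ?_) fun y hy => ?_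
    · rw [← (hsummable N x hx).tsum_add (hsummable N y hy)]
      exact tsum_congr fun i => bandComponent_add hf (ha _) hx hy
    · rw [abs_of_nonneg (htnn N y hy)]
      refine ((hsummable N y hy).tsum_le_of_sum_le (hsum N y hy)).trans ?_
      exact (le_abs_self _).trans (f.le_opNorm y)
  -- `t N` is the tail from `N` on of the series of band components of `f`.
  choose t ht using ht
  have hstep : ∀ N y, 0 ≤ y → t N y = p N y + t (N + 1) y := fun N y hy => by
    rw [ht N y hy, ht (N + 1) y hy, (hsummable N y hy).tsum_eq_zero_add]
    simp only [zero_add, add_right_comm, add_assoc]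
  have htn : ∀ N, 0 ≤ t N := fun N y hy => by
    rw [ht N y hy]
    exact htnn N y hy
  have hanti : Antitone t := antitone_nat_of_succ_le fun N y hy => by
    rw [hstep N y hy]
    exact le_add_of_nonneg_left (hpnn N y hy)
  have hglb : IsGLB (Set.range fun N : ULift.{u} ℕ => t N.down) 0 := by
    refine ⟨by rintro _ ⟨N, rfl⟩; exact htn _, fun g hg y hy => ?_⟩
    refine ge_of_tendsto' (tendsto_sum_nat_add fun i => p i y) fun N => ?_
    rw [← ht N y hy]
    exact hg ⟨ULift.up N, rfl⟩ y hy
  have hlim := h (ULift.{u} ℕ) (fun N => t N.down) (fun N K hNK => hanti hNK) hglb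
  have hlim' : Tendsto (fun n => ‖t n‖) atTop (𝓝 0) := by
    exact hlim.comp tendsto_ulift_up_nat
  have hM' : Tendsto (fun n => ‖t n‖ * M) atTop (𝓝 0) := by simpa using hlim'.mul_const M
  refine squeeze_zero (fun n => dual_nonneg_apply hf (ha n)) (fun n => ?_) hM'
  calc f (a n) = f (a n ⊓ 1 • a n) := by simp
    _ ≤ p n (a n) := le_bandComponent hf _ _ 1
    _ ≤ t n (a n) := by
      rw [hstep n _ (ha n)]
      exact le_add_of_nonneg_right (dual_nonneg_apply (htn _) (ha n))
    _ ≤ ‖t n‖ * ‖a n‖ := (le_abs_self _).trans ((t n).le_opNorm _)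
    _ ≤ ‖t n‖ * M := mul_le_mul_of_nonneg_left (hM n) (norm_nonneg _)

/-- Every norm ball is, up to an arbitrarily small error measured by a given positive functional,
contained in an order interval. -/
def BallsAlmostOrderBounded (E : Type u) [NormedAddCommGroup E] [NormedSpace ℝ E] [Lattice E]
    [IsOrderedAddMonoid E] : Prop :=
  ∀ f : StrongDual ℝ E, 0 ≤ f → ∀ M ε : ℝ, 0 < ε →
    ∃ u : E, 0 ≤ u ∧ ∀ x : E, 0 ≤ x → ‖x‖ ≤ M → f (x - u)⁺ ≤ ε

/-- Gliding hump: if no `u` works, elements of the ball can be chosen that each escape large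
multiples of their predecessors; trimming them makes them disjoint while `f` stays away from `0`. -/
theorem ballsAlmostOrderBounded_of_disjoint [CompleteSpace E] [IsOrderedModule ℝ E]
    (h : ∀ f : StrongDual ℝ E, 0 ≤ f → ∀ a : ℕ → E, (∀ n, 0 ≤ a n) →
      (Pairwise fun i j => a i ⊓ a j = 0) → ∀ M : ℝ, (∀ n, ‖a n‖ ≤ M) →
      Tendsto (fun n => f (a n)) atTop (𝓝 0)) :
    BallsAlmostOrderBounded E := by
  intro f hf M ε hε
  by_contra! hcon
  choose! F hF0 hFM hFε using hcon
  -- `v n` is the sum of the earlier choices, and `a n` exceeds `4 ^ n • v n` by more than `ε` under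
  -- `f`.
  let v : ℕ → E := fun n => Nat.rec 0 (fun k w => w + F ((4 : ℝ) ^ k • w)) n
  let a : ℕ → E := fun n => F ((4 : ℝ) ^ n • v n)
  have hvs : ∀ n, v (n + 1) = v n + a n := fun n => rfl
  have hv : ∀ n, 0 ≤ v n := fun n => by
    induction n with
    | zero => exact le_rfl
    | succ n ih =>
      rw [hvs]
      exact add_nonneg ih (hF0 _ (smul_nonneg (by positivity) ih))
  have h4v : ∀ n, 0 ≤ (4 : ℝ) ^ n • v n := fun n => smul_nonneg (by positivity) (hv n)
  have ha : ∀ n, 0 ≤ a n := fun n => hF0 _ (h4v n)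
  have haM : ∀ n, ‖a n‖ ≤ M := fun n => hFM _ (h4v n)
  have haε : ∀ n, ε < f (a n - (4 : ℝ) ^ n • v n)⁺ := fun n => hFε _ (h4v n)
  have hvmono : Monotone v := monotone_nat_of_le_succ fun n => by
    rw [hvs]
    exact le_add_of_nonneg_right (ha n)
  have hav : ∀ {m n}, m < n → a m ≤ v n := fun {m n} hmn =>
    le_trans (by rw [hvs]; exact le_add_of_nonneg_left (hv m)) (hvmono (Nat.succ_le_of_lt hmn))
  have hsum : Summable fun n => ((2 : ℝ) ^ n)⁻¹ • a n := by
    refine Summable.of_norm_bounded (g := fun n => (1 / 2 : ℝ) ^ n * M)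
      (summable_geometric_two.mul_right M) fun n => ?_
    rw [norm_smul, norm_inv, norm_pow, Real.norm_ofNat, one_div, inv_pow]
    exact mul_le_mul_of_nonneg_left (haM n) (by positivity)
  set w : E := ∑' n, ((2 : ℝ) ^ n)⁻¹ • a n with hw
  have hterm : ∀ n, 0 ≤ ((2 : ℝ) ^ n)⁻¹ • a n := fun n => smul_nonneg (by positivity) (ha n)
  have haw : ∀ n, ((2 : ℝ) ^ n)⁻¹ • a n ≤ w := fun n =>
    hsum.le_tsum n fun i _ => hterm i
  have hw0 : 0 ≤ w := tsum_nonneg hterm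
  -- Subtracting `4 ^ n • v n` trims against earlier terms, subtracting a multiple of `w` against
  -- later ones; the latter costs only `2⁻ⁿ f w`.
  let b : ℕ → E := fun n => (a n - (4 : ℝ) ^ n • v n - ((2 : ℝ) ^ n)⁻¹ • w)⁺
  have hb : ∀ n, 0 ≤ b n := fun n => posPart_nonneg _
  have h2w : ∀ n, 0 ≤ ((2 : ℝ) ^ n)⁻¹ • w := fun n => smul_nonneg (by positivity) hw0
  have hbM : ∀ n, ‖b n‖ ≤ M := fun n => by
    refine (norm_le_norm_of_nonneg_of_le (hb n) (sup_le ?_ (ha n))).trans (haM n)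
    exact (sub_le_self _ (h2w n)).trans (sub_le_self _ (h4v n))
  have hdlt : ∀ {m n}, m < n → b m ⊓ b n = 0 := fun {m n} hmn => by
    refine inf_eq_zero_mono (hb m) (hb n) ?_ ?_
      (posPart_sub_inf_posPart_sub_swap ((4 : ℝ) ^ n • a m) (a n))
    -- As `w ≥ 2⁻ⁿ a n`, trimming leaves `b m ≤ (a m - 2⁻ᵐ⁻ⁿ a n)⁺`; the bounds `1 ≤ 2ᵐ⁺ⁿ ≤ 4ⁿ` then
    -- give the comparison.
    · have hc : (1 : ℝ) ≤ 2 ^ m * 2 ^ n := by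
        rw [← pow_add]; exact one_le_pow₀ (by norm_num)
      have hc4 : (2 : ℝ) ^ m * 2 ^ n ≤ 4 ^ n := by
        have : (4 : ℝ) ^ n = 2 ^ n * 2 ^ n := by rw [← mul_pow]; norm_num
        rw [this]
        exact mul_le_mul_of_nonneg_right (pow_le_pow_right₀ (by norm_num) hmn.le) (by positivity)
      have h1 : b m ≤ (a m - ((2 : ℝ) ^ m * 2 ^ n)⁻¹ • a n)⁺ := by
        refine posPart_mono (sub_le_sub (sub_le_self _ (h4v m)) ?_)
        rw [mul_inv, mul_smul]
        exact smul_le_smul_of_nonneg_left (haw n) (by positivity)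
      refine h1.trans (le_trans (b := ((2 : ℝ) ^ m * 2 ^ n)⁻¹ • ((4 : ℝ) ^ n • a m - a n)⁺) ?_
        (smul_le_of_le_one_left (posPart_nonneg _) (inv_le_one_of_one_le₀ hc)))
      refine sup_le ?_ (smul_nonneg (by positivity) (posPart_nonneg _))
      rw [le_inv_smul_iff_of_pos (by positivity), smul_sub, smul_inv_smul₀ (by positivity)]
      exact (sub_le_sub_right (smul_le_smul_of_nonneg_right hc4 (ha m)) _).trans (le_posPart _)
    · refine posPart_mono ((sub_le_self _ (h2w n)).trans (sub_le_sub_left ?_ _))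
      exact smul_le_smul_of_nonneg_left (hav hmn) (by positivity)
  have hd : Pairwise fun i j => b i ⊓ b j = 0 := fun i j hij => by
    rcases hij.lt_or_gt with h | h
    · exact hdlt h
    · rw [inf_comm]; exact hdlt h
  have hlim : Tendsto (fun n => f (b n) + ((2 : ℝ) ^ n)⁻¹ * f w) atTop (𝓝 0) := by
    have h1 : Tendsto (fun n : ℕ => ((2 : ℝ) ^ n)⁻¹) atTop (𝓝 0) := by
      simpa [inv_pow] using
        tendsto_pow_atTop_nhds_zero_of_lt_one (r := (2 : ℝ)⁻¹) (by norm_num) (by norm_num)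
    simpa using (h f hf b hb hd M hbM).add (h1.mul_const (f w))
  refine hε.not_ge (ge_of_tendsto' hlim fun n => (haε n).le.trans ?_)
  rw [← smul_eq_mul, ← map_smul, ← map_add]
  refine dual_mono_of_nonneg hf (sup_le ?_ (add_nonneg (hb n) (h2w n)))
  rw [← sub_le_iff_le_add]
  exact le_posPart _

/-- The pointwise infimum of a net `φ ↓ 0` is itself a functional, hence `0`. On the unit ball, `φ i
|z|` is at most `φ i u` plus an error controlled by the fixed `φ i₀`, so the convergence is uniform.
-/
theorem BallsAlmostOrderBounded.orderContinuousNorm_dual (h : BallsAlmostOrderBounded E) :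
    OrderContinuousNorm (StrongDual ℝ E) := by
  intro ι _ _ _ φ hanti hglb
  have hnn : ∀ i, 0 ≤ φ i := fun i => hglb.1 ⟨i, rfl⟩
  obtain ⟨i₀⟩ := ‹Nonempty ι›
  have hbdd : ∀ y : E, 0 ≤ y → BddBelow (Set.range fun i => φ i y) := fun y hy =>
    ⟨0, by rintro _ ⟨i, rfl⟩; exact dual_nonneg_apply (hnn i) hy⟩
  have hlim : ∀ y : E, 0 ≤ y → Tendsto (fun i => φ i y) atTop (𝓝 (⨅ i, φ i y)) := fun y hy =>
    tendsto_atTop_ciInf (fun i j hij => hanti hij y hy) (hbdd y hy)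
  have hinn : ∀ y : E, 0 ≤ y → 0 ≤ ⨅ i, φ i y := fun y hy =>
    Real.iInf_nonneg fun i => dual_nonneg_apply (hnn i) hy
  obtain ⟨g, hg⟩ := exists_dual_eq_on_nonneg (fun y : E => ⨅ i, φ i y) ‖φ i₀‖
    (fun x y hx hy => tendsto_nhds_unique (hlim _ (add_nonneg hx hy)) (by
      simpa only [map_add] using (hlim x hx).add (hlim y hy)))
    (fun y hy => by
      rw [abs_of_nonneg (hinn y hy)]
      exact (ciInf_le (hbdd y hy) i₀).trans ((le_abs_self _).trans ((φ i₀).le_opNorm y)))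
  have hg0 : g ≤ 0 := hglb.2 (by
    rintro _ ⟨i, rfl⟩ y hy
    rw [hg y hy]
    exact ciInf_le (hbdd y hy) i)
  have hlim0 : ∀ y : E, 0 ≤ y → Tendsto (fun i => φ i y) atTop (𝓝 0) := fun y hy => by
    have : ⨅ i, φ i y = 0 := le_antisymm ((hg y hy).symm.le.trans (hg0 y hy)) (hinn y hy)
    simpa only [this] using hlim y hy
  rw [Metric.tendsto_nhds]
  intro ε hε
  obtain ⟨u, hu, hux⟩ := h (φ i₀) (hnn i₀) 1 (ε / 3) (by positivity)
  filter_upwards [eventually_ge_atTop i₀, (hlim0 u hu).eventually_lt_const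
    (show 0 < ε / 3 by positivity)] with i hi hiu
  rw [Real.dist_0_eq_abs, abs_norm]
  refine lt_of_le_of_lt (b := 2 * (ε / 3)) ?_ (by linarith)
  refine ContinuousLinearMap.opNorm_le_of_unit_norm (by positivity) fun z hz => ?_
  have h1 : φ i |z| = φ i (|z| ⊓ u) + φ i (|z| - u)⁺ := by
    rw [← sub_inf_eq_posPart_sub, ← map_add, add_sub_cancel]
  have h2 := dual_mono_of_nonneg (hnn i) (inf_le_right : |z| ⊓ u ≤ u)
  have h3 : φ i (|z| - u)⁺ ≤ φ i₀ (|z| - u)⁺ := hanti hi _ (posPart_nonneg _)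
  have h4 := hux |z| (abs_nonneg z) (by rw [norm_abs_eq_norm, hz])
  have h5 := abs_apply_le_apply_abs (hnn i) z
  rw [Real.norm_eq_abs]
  linarith

end

end BanachLattice

namespace BanachLattice

/-! ### Modes of convergence and disjoint sequences -/

section

variable {E : Type u} [NormedAddCommGroup E] [NormedSpace ℝ E] [Lattice E]

omit [Lattice E] in
theorem weakConv_iff {ι : Type v} [Preorder ι] {x : ι → E} {a : E} :
    WeakConv x a ↔ ∀ f : StrongDual ℝ E, Tendsto (fun i => f (x i)) atTop (𝓝 (f a)) := by
  have hind : IsInducing fun (y : WeakSpace ℝ E) (f : StrongDual ℝ E) =>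
      (topDualPairing ℝ E).flip y f := ⟨rfl⟩
  unfold WeakConv
  rw [hind.tendsto_nhds_iff, tendsto_pi_nhds]
  rfl

variable [IsOrderedAddMonoid E] [HasSolidNorm E]

theorem weakConv_zero_iff {ι : Type v} [Preorder ι] {x : ι → E} :
    WeakConv x 0 ↔ ∀ f : StrongDual ℝ E, 0 ≤ f → Tendsto (fun i => f (x i)) atTop (𝓝 0) := by
  rw [weakConv_iff]
  refine ⟨fun h f _ => by simpa using h f, fun h f => ?_⟩
  obtain ⟨g, k, hg, hk, rfl⟩ := exists_nonneg_sub_nonneg f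
  simpa using (h g hg).sub (h k hk)

theorem AbsWeakConv.weakConv_zero {ι : Type v} [Preorder ι] {x : ι → E} (h : AbsWeakConv x 0) :
    WeakConv x 0 := by
  refine weakConv_zero_iff.2 fun f hf => squeeze_zero_norm (fun i => ?_) (h f hf)
  rw [sub_zero]
  exact abs_apply_le_apply_abs hf (x i)

omit [IsOrderedAddMonoid E] [HasSolidNorm E] in
theorem UNConv.uawConv_zero {ι : Type v} [Preorder ι] {x : ι → E} (h : UNConv x 0) :
    UAWConv x 0 := fun u hu =>
  weakConv_iff.2 fun f =>
    (f.continuous.tendsto 0).comp (tendsto_zero_iff_norm_tendsto_zero.2 (h u hu))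

omit [NormedSpace ℝ E] in
theorem UOConv.unConv_zero (hE : OrderContinuousNorm E) {ι : Type v} [Preorder ι]
    [IsDirectedOrder ι] [Nonempty ι] {x : ι → E} (h : UOConv x 0) : UNConv x 0 := by
  intro u hu
  obtain ⟨κ, _, _, _, y, hy, hglb, hxy⟩ := h u hu
  have hlim := hE κ y hy hglb
  rw [Metric.tendsto_nhds]
  intro ε hε
  obtain ⟨k, hk⟩ := (hlim.eventually_lt_const hε).exists
  obtain ⟨i₀, hi₀⟩ := hxy k
  filter_upwards [eventually_ge_atTop i₀] with i hi
  rw [Real.dist_0_eq_abs, abs_norm]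
  refine lt_of_le_of_lt ?_ hk
  have := norm_le_norm_of_nonneg_of_le (abs_nonneg _) (hi₀ i hi)
  rwa [norm_abs_eq_norm, sub_zero] at this

theorem BallsAlmostOrderBounded.absWeakConv_zero (h : BallsAlmostOrderBounded E) {ι : Type v}
    [Preorder ι] {x : ι → E} (hb : Bornology.IsBounded (Set.range x)) (hx : UAWConv x 0) :
    AbsWeakConv x 0 := by
  intro f hf
  obtain ⟨M, hM⟩ := hb.exists_norm_le
  rw [Metric.tendsto_nhds]
  intro ε hε
  obtain ⟨u, hu, hux⟩ := h f hf M (ε / 2) (by positivity)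
  filter_upwards [(weakConv_zero_iff.1 (hx u hu) f hf).eventually_lt_const
    (show 0 < ε / 2 by positivity)] with i hi
  rw [sub_zero] at hi ⊢
  rw [Real.dist_0_eq_abs, abs_of_nonneg (dual_nonneg_apply hf (abs_nonneg _))]
  have h1 : f |x i| = f (|x i| ⊓ u) + f (|x i| - u)⁺ := by
    rw [← sub_inf_eq_posPart_sub, ← map_add, add_sub_cancel]
  have h2 := hux |x i| (abs_nonneg _) (by rw [norm_abs_eq_norm]; exact hM _ ⟨i, rfl⟩)
  linarith

/-- The truncations `x n ⊓ u` are disjoint and below `u`, so their values under `f` are summable. -/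
theorem uawConv_zero_of_disjoint {x : ℕ → E} (hx : ∀ n, 0 ≤ x n)
    (hd : Pairwise fun i j => x i ⊓ x j = 0) : UAWConv x 0 := by
  intro u hu
  refine weakConv_zero_iff.2 fun f hf => ?_
  simp only [sub_zero, abs_of_nonneg (hx _)]
  have hnn : ∀ n, 0 ≤ x n ⊓ u := fun n => le_inf (hx n) hu
  have hs : Summable fun n => f (x n ⊓ u) := by
    refine summable_of_sum_le (c := f u) (fun n => dual_nonneg_apply hf (hnn n)) fun s => ?_
    rw [← map_sum]
    exact dual_mono_of_nonneg hf (sum_le_of_pairwise_inf_eq_zero s hnn hu (fun _ => inf_le_right)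
      fun i j hij => inf_eq_zero_mono (hnn i) (hnn j) inf_le_left inf_le_left (hd hij))
  exact hs.tendsto_atTop_zero

theorem eq_zero_of_forall_nsmul_le {c u : E} (hc : 0 ≤ c) (h : ∀ n : ℕ, n • c ≤ u) : c = 0 := by
  by_contra hne
  obtain ⟨n, hn⟩ := exists_nat_gt (‖u‖ / ‖c‖)
  have h1 := norm_le_norm_of_nonneg_of_le (nsmul_nonneg hc n) (h n)
  rw [← Nat.cast_smul_eq_nsmul ℝ, norm_smul, Real.norm_natCast] at h1
  rw [div_lt_iff₀ (norm_pos_iff.2 hne)] at hn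
  exact hn.not_ge h1

/-- An order bounded disjoint positive sequence converges in order to zero. -/
theorem orderConv_zero_of_disjoint {z : ℕ → E} {u : E} (hz : ∀ n, 0 ≤ z n)
    (hd : Pairwise fun i j => z i ⊓ z j = 0) (hzu : ∀ n, z n ≤ u) : OrderConv z 0 := by
  -- Suprema of tails need not exist, so the dominating net consists of all eventual upper bounds,
  -- directed downwards.
  set D : Set E := {y | ∃ n, ∀ m, n ≤ m → z m ≤ y} with hD
  have hdir : IsDirectedOrder (D)ᵒᵈ := ⟨by
    rintro ⟨a, n, hn⟩ ⟨b, k, hk⟩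
    exact ⟨OrderDual.toDual ⟨a ⊓ b, max n k, fun m hm =>
      le_inf (hn m (le_of_max_le_left hm)) (hk m (le_of_max_le_right hm))⟩,
      (inf_le_left : a ⊓ b ≤ a), (inf_le_right : a ⊓ b ≤ b)⟩⟩
  have hne : Nonempty (D)ᵒᵈ := ⟨OrderDual.toDual ⟨u, 0, fun m _ => hzu m⟩⟩
  refine ⟨(D)ᵒᵈ, inferInstance, hdir, hne, fun k => (OrderDual.ofDual k).1,
    fun i j hij => hij, ⟨?_, fun w hw => ?_⟩, ?_⟩
  · rintro _ ⟨⟨y, n, hn⟩, rfl⟩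
    exact (hz n).trans (hn n le_rfl)
  · have hwD : ∀ y ∈ D, w⁺ ≤ y := fun y hy => by
      refine sup_le (hw ⟨OrderDual.toDual ⟨y, hy⟩, rfl⟩) ?_
      obtain ⟨n, hn⟩ := hy
      exact (hz n).trans (hn n le_rfl)
    have hwz : ∀ k, w⁺ ⊓ z k = 0 := fun k => by
      have hc : 0 ≤ w⁺ ⊓ z k := le_inf (posPart_nonneg w) (hz k)
      refine eq_zero_of_forall_nsmul_le (u := u) hc fun N => ?_
      induction N with
      | zero => simpa using (hz 0).trans (hzu 0)
      | succ N ih =>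
        -- Later `z m` are disjoint from `z k`, so `(u - N • z k)⁺` is still an eventual upper
        -- bound.
        have h1 : w⁺ ≤ (u - N • z k)⁺ := hwD _ ⟨k + 1, fun m hm => by
          have h2 : (N • z k) ⊓ z m = 0 :=
            nsmul_inf_eq_zero (hz k) (hz m) (hd (Nat.ne_of_lt hm)) N
          calc z m = (z m - N • z k)⁺ := by
                rw [← sub_inf_eq_posPart_sub, inf_comm, h2, sub_zero]
            _ ≤ _ := posPart_mono (sub_le_sub_right (hzu m) _)⟩
        have h3 : w⁺ ⊓ z k ≤ (u - N • (w⁺ ⊓ z k))⁺ :=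
          inf_le_left.trans (h1.trans
            (posPart_mono (sub_le_sub_left (nsmul_le_nsmul_right inf_le_right N) u)))
        rw [posPart_of_nonneg (sub_nonneg.2 ih), le_sub_iff_add_le'] at h3
        rwa [succ_nsmul]
    have hw0 : w⁺ = 0 := by
      -- Being disjoint from every `z m`, `w⁺` can be subtracted from an upper bound of all of them
      -- repeatedly.
      have key : ∀ N : ℕ, ∀ m, z m ≤ u - N • w⁺ := fun N => by
        induction N with
        | zero => simpa using hzu
        | succ N ih =>
          intro m
          have h1 := add_le_of_inf_eq_zero (hwz m) (hwD _ ⟨0, fun m _ => ih m⟩) (ih m)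
          rw [succ_nsmul, ← sub_sub, le_sub_iff_add_le']
          exact h1
      refine eq_zero_of_forall_nsmul_le (u := u) (posPart_nonneg w) fun N => ?_
      exact sub_nonneg.1 ((hz 0).trans (key N 0))
    exact posPart_eq_zero.1 hw0
  · rintro ⟨y, n, hn⟩
    refine ⟨n, fun m hm => ?_⟩
    rw [sub_zero, abs_of_nonneg (hz m)]
    exact hn m hm

theorem uoConv_zero_of_disjoint {x : ℕ → E} (hx : ∀ n, 0 ≤ x n)
    (hd : Pairwise fun i j => x i ⊓ x j = 0) : UOConv x 0 := by
  intro u hu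
  simp only [sub_zero, abs_of_nonneg (hx _)]
  have hnn : ∀ n, 0 ≤ x n ⊓ u := fun n => le_inf (hx n) hu
  exact orderConv_zero_of_disjoint hnn (fun i j hij =>
    inf_eq_zero_mono (hnn i) (hnn j) inf_le_left inf_le_left (hd hij)) fun _ => inf_le_right

/-- If every norm bounded disjoint positive sequence is weakly null, then the dual norm is order
continuous. -/
theorem orderContinuousNorm_dual_of_disjoint [CompleteSpace E] [IsOrderedModule ℝ E]
    (h : ∀ a : ℕ → E, Bornology.IsBounded (Set.range a) → (∀ n, 0 ≤ a n) →
      (Pairwise fun i j => a i ⊓ a j = 0) → WeakConv a 0) :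
    OrderContinuousNorm (StrongDual ℝ E) := by
  refine (ballsAlmostOrderBounded_of_disjoint fun f hf a ha hd M hM =>
    weakConv_zero_iff.1 (h a ?_ ha hd) f hf).orderContinuousNorm_dual
  exact isBounded_iff_forall_norm_le.2 ⟨M, by rintro _ ⟨n, rfl⟩; exact hM n⟩

theorem OrderContinuousNorm.ballsAlmostOrderBounded [CompleteSpace E] [IsOrderedModule ℝ E]
    (h : OrderContinuousNorm (StrongDual ℝ E)) : BallsAlmostOrderBounded E :=
  ballsAlmostOrderBounded_of_disjoint fun _ hf _ ha hd _ hM =>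
    h.tendsto_apply_of_disjoint hf ha hd hM

omit [IsOrderedAddMonoid E] [HasSolidNorm E] in
-- Nets are indexed in universe `v`, so a sequence is viewed as a net over `ULift ℕ`.
theorem UAWConv.comp_ulift_down {x : ℕ → E} {a : E} (h : UAWConv x a) :
    UAWConv (fun i : ULift.{v} ℕ => x i.down) a :=
  fun u hu => (h u hu).comp tendsto_ulift_down_nat

omit [NormedSpace ℝ E] [IsOrderedAddMonoid E] [HasSolidNorm E] in
theorem UOConv.comp_ulift_down {x : ℕ → E} {a : E} (h : UOConv x a) :
    UOConv (fun i : ULift.{v} ℕ => x i.down) a := by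
  intro u hu
  obtain ⟨κ, i₁, i₂, i₃, y, hy, hglb, hxy⟩ := h u hu
  refine ⟨κ, i₁, i₂, i₃, y, hy, hglb, fun k => ?_⟩
  obtain ⟨n, hn⟩ := hxy k
  exact ⟨ULift.up n, fun i hi => hn i.down hi⟩

omit [Lattice E] [IsOrderedAddMonoid E] [HasSolidNorm E] in
theorem WeakConv.of_comp_ulift_down {x : ℕ → E} {a : E}
    (h : WeakConv (fun i : ULift.{v} ℕ => x i.down) a) : WeakConv x a :=
  weakConv_iff.2 fun f => (weakConv_iff.1 h f).comp tendsto_ulift_up_nat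

end

end BanachLattice

/-! ### The equivalences -/

open BanachLattice in
theorem mainTheorem2 (E : Type u) [NormedAddCommGroup E] [NormedSpace ℝ E] [CompleteSpace E]
    [Lattice E] [IsOrderedAddMonoid E] [IsOrderedModule ℝ E] [HasSolidNorm E] :
    List.TFAE [
      BanachLattice.OrderContinuousNorm (StrongDual ℝ E),
      ∀ (ι : Type v) [Preorder ι] [IsDirectedOrder ι] [Nonempty ι] (x : ι → E),
        Bornology.IsBounded (Set.range x) → BanachLattice.UAWConv x 0 → BanachLattice.WeakConv x 0,
      ∀ (ι : Type v) [Preorder ι] [IsDirectedOrder ι] [Nonempty ι] (x : ι → E),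
        Bornology.IsBounded (Set.range x) → BanachLattice.UAWConv x 0 → BanachLattice.AbsWeakConv x 0,
      ∀ x : ℕ → E,
        Bornology.IsBounded (Set.range x) → BanachLattice.UAWConv x 0 → BanachLattice.WeakConv x 0,
      ∀ x : ℕ → E,
        Bornology.IsBounded (Set.range x) → BanachLattice.UAWConv x 0 → BanachLattice.AbsWeakConv x 0] ∧
    (BanachLattice.OrderContinuousNorm E → List.TFAE [
      BanachLattice.OrderContinuousNorm (StrongDual ℝ E),
      ∀ (ι : Type v) [Preorder ι] [IsDirectedOrder ι] [Nonempty ι] (x : ι → E),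
        Bornology.IsBounded (Set.range x) → BanachLattice.UAWConv x 0 → BanachLattice.WeakConv x 0,
      ∀ (ι : Type v) [Preorder ι] [IsDirectedOrder ι] [Nonempty ι] (x : ι → E),
        Bornology.IsBounded (Set.range x) → BanachLattice.UAWConv x 0 → BanachLattice.AbsWeakConv x 0,
      ∀ x : ℕ → E,
        Bornology.IsBounded (Set.range x) → BanachLattice.UAWConv x 0 → BanachLattice.WeakConv x 0,
      ∀ x : ℕ → E,
        Bornology.IsBounded (Set.range x) → BanachLattice.UAWConv x 0 → BanachLattice.AbsWeakConv x 0,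
      ∀ (ι : Type v) [Preorder ι] [IsDirectedOrder ι] [Nonempty ι] (x : ι → E),
        Bornology.IsBounded (Set.range x) → BanachLattice.UOConv x 0 → BanachLattice.WeakConv x 0,
      ∀ (ι : Type v) [Preorder ι] [IsDirectedOrder ι] [Nonempty ι] (x : ι → E),
        Bornology.IsBounded (Set.range x) → BanachLattice.UOConv x 0 → BanachLattice.AbsWeakConv x 0,
      ∀ x : ℕ → E,
        Bornology.IsBounded (Set.range x) → BanachLattice.UOConv x 0 → BanachLattice.WeakConv x 0,
      ∀ x : ℕ → E,
        Bornology.IsBounded (Set.range x) → BanachLattice.UOConv x 0 → BanachLattice.AbsWeakConv x 0,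
      ∀ (ι : Type v) [Preorder ι] [IsDirectedOrder ι] [Nonempty ι] (x : ι → E),
        Bornology.IsBounded (Set.range x) → BanachLattice.UNConv x 0 → BanachLattice.WeakConv x 0,
      ∀ (ι : Type v) [Preorder ι] [IsDirectedOrder ι] [Nonempty ι] (x : ι → E),
        Bornology.IsBounded (Set.range x) → BanachLattice.UNConv x 0 → BanachLattice.AbsWeakConv x 0,
      ∀ x : ℕ → E,
        Bornology.IsBounded (Set.range x) → BanachLattice.UNConv x 0 → BanachLattice.WeakConv x 0,
      ∀ x : ℕ → E,
        Bornology.IsBounded (Set.range x) → BanachLattice.UNConv x 0 → BanachLattice.AbsWeakConv x 0]) := by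
  have h13 : OrderContinuousNorm (StrongDual ℝ E) →
      ∀ (ι : Type v) [Preorder ι] [IsDirectedOrder ι] [Nonempty ι] (x : ι → E),
        Bornology.IsBounded (Set.range x) → UAWConv x 0 → AbsWeakConv x 0 :=
    fun h ι _ _ _ x hb hx => h.ballsAlmostOrderBounded.absWeakConv_zero hb hx
  have h15 : OrderContinuousNorm (StrongDual ℝ E) →
      ∀ x : ℕ → E, Bornology.IsBounded (Set.range x) → UAWConv x 0 → AbsWeakConv x 0 :=
    fun h x hb hx => h.ballsAlmostOrderBounded.absWeakConv_zero hb hx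
  have hlift : ∀ a : ℕ → E, Bornology.IsBounded (Set.range a) →
      Bornology.IsBounded (Set.range fun i : ULift.{v} ℕ => a i.down) :=
    fun a hb => hb.subset (Set.range_comp_subset_range _ _)
  constructor
  · tfae_have 1 → 3 := h13
    tfae_have 1 → 5 := h15
    tfae_have 3 → 2 := fun h ι _ _ _ x hb hx => (h ι x hb hx).weakConv_zero
    tfae_have 5 → 4 := fun h x hb hx => (h x hb hx).weakConv_zero
    tfae_have 2 → 1 := fun h => orderContinuousNorm_dual_of_disjoint fun a hb ha hd =>
      (h (ULift.{v} ℕ) (fun i => a i.down) (hlift a hb)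
        (uawConv_zero_of_disjoint ha hd).comp_ulift_down).of_comp_ulift_down
    tfae_have 4 → 1 := fun h => orderContinuousNorm_dual_of_disjoint fun a hb ha hd =>
      h a hb (uawConv_zero_of_disjoint ha hd)
    tfae_finish
  · intro hE
    tfae_have 1 → 3 := h13
    tfae_have 1 → 5 := h15
    tfae_have 3 → 2 := fun h ι _ _ _ x hb hx => (h ι x hb hx).weakConv_zero
    tfae_have 5 → 4 := fun h x hb hx => (h x hb hx).weakConv_zero
    tfae_have 3 → 11 := fun h ι _ _ _ x hb hx => h ι x hb hx.uawConv_zero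
    tfae_have 11 → 7 := fun h ι _ _ _ x hb hx => h ι x hb (hx.unConv_zero hE)
    tfae_have 7 → 6 := fun h ι _ _ _ x hb hx => (h ι x hb hx).weakConv_zero
    tfae_have 2 → 10 := fun h ι _ _ _ x hb hx => h ι x hb hx.uawConv_zero
    tfae_have 10 → 6 := fun h ι _ _ _ x hb hx => h ι x hb (hx.unConv_zero hE)
    tfae_have 5 → 13 := fun h x hb hx => h x hb hx.uawConv_zero
    tfae_have 13 → 9 := fun h x hb hx => h x hb (hx.unConv_zero hE)
    tfae_have 9 → 8 := fun h x hb hx => (h x hb hx).weakConv_zero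
    tfae_have 4 → 12 := fun h x hb hx => h x hb hx.uawConv_zero
    tfae_have 12 → 8 := fun h x hb hx => h x hb (hx.unConv_zero hE)
    -- The cycles close at the weakest conditions, since disjoint sequences are already uo-null.
    tfae_have 6 → 1 := fun h => orderContinuousNorm_dual_of_disjoint fun a hb ha hd =>
      (h (ULift.{v} ℕ) (fun i => a i.down) (hlift a hb)
        (uoConv_zero_of_disjoint ha hd).comp_ulift_down).of_comp_ulift_down
    tfae_have 8 → 1 := fun h => orderContinuousNorm_dual_of_disjoint fun a hb ha hd =>
      h a hb (uoConv_zero_of_disjoint ha hd)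
    tfae_finish
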